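/- Let $n\ge 1$ and let $S^n\subset\mathbb{R}^{n+1}$ be the standard unit sphere with north pole $p_0=(1,0,\dots,0)$. For $k\ge 0$ let $\mathcal{H}^n_k$ be the space of real spherical harmonics of degree $k$ on $S^n$, i.e. the restrictions to $S^n$ of homogeneous harmonic polynomials of degree $k$ in $n+1$ real variables. For a function $Y$ on $S^n$, the connected components of $\{Y\neq 0\}$ are called the nodal domains of $Y$. There exist constants $c_{1,n}>0$ and $c_{2,n}>0$, depending only on $n$, and a sequence $(Y^n_k)_{k\ge 1}$ with $Y^n_k\in\mathcal{H}^n_k$ such that for every $k\ge 1$: 1. the number of nodal domains of $Y^n_k$ is at least $c_{1,n}k^n$; 2. at least $c_{2,n}k^{n-1}$ nodal domains of $Y^n_k$ have the north pole $p_0$ on their boundary. -/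

import Mathlib

open scoped ENNReal

noncomputable section

namespace SphereNodal

/-- The ambient Euclidean space `ℝ^{n+1}` of the sphere `S^n`. -/
abbrev Ambient (n : ℕ) : Type := EuclideanSpace ℝ (Fin (n + 1))

/-- The standard unit sphere `S^n ⊆ ℝ^{n+1}`. -/
abbrev Sph (n : ℕ) : Type := Metric.sphere (0 : Ambient n) 1

/-- The Laplacian `∑ ∂²/∂xᵢ²` on real polynomials in `n + 1` variables. -/
def polyLaplacian (n : ℕ) :
    MvPolynomial (Fin (n + 1)) ℝ →ₗ[ℝ] MvPolynomial (Fin (n + 1)) ℝ :=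
  ∑ i : Fin (n + 1),
    (MvPolynomial.pderiv i).toLinearMap ∘ₗ (MvPolynomial.pderiv i).toLinearMap

/-- The real polynomials in `n + 1` variables that are homogeneous of degree `k` and harmonic. -/
def harmonicPolynomials (n k : ℕ) : Submodule ℝ (MvPolynomial (Fin (n + 1)) ℝ) :=
  MvPolynomial.homogeneousSubmodule (Fin (n + 1)) ℝ k ⊓ LinearMap.ker (polyLaplacian n)

/-- Restriction of a polynomial to the sphere, as a real function on `S^n`. -/
def restrictToSphere (n : ℕ) : MvPolynomial (Fin (n + 1)) ℝ →ₗ[ℝ] (Sph n → ℝ) where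
  toFun p := fun x => MvPolynomial.eval (fun i => (x : Ambient n) i) p
  map_add' p q := by ext x; simp
  map_smul' a p := by ext x; simp

/-- The space of (real) spherical harmonics of degree `k` on `S^n`: restrictions to the sphere of
homogeneous harmonic polynomials of degree `k` in `n + 1` variables. -/
def sphericalHarmonics (n k : ℕ) : Submodule ℝ (Sph n → ℝ) :=
  (harmonicPolynomials n k).map (restrictToSphere n)

/-- The nodal domains of `f`: the connected components of the set `{f ≠ 0}`. -/
def nodalDomains {X : Type*} [TopologicalSpace X] (f : X → ℝ) : Set (Set X) :=
  {Ω | ∃ x ∈ {y | f y ≠ 0}, Ω = connectedComponentIn {y | f y ≠ 0} x}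

/-- The north pole `(1, 0, …, 0)` of `S^n`. -/
def northPole (n : ℕ) : Sph n :=
  ⟨EuclideanSpace.single 0 1, by simp⟩

end SphereNodal

end

/-!
The Kelvin transform `F ↦ F / |x| ^ (2 d + N - 2)` of degree-`d` homogeneous polynomials in `N`
variables preserves harmonicity and conjugates `-∂₀` to an operator raising the degree of harmonic
polynomials by one. Raise `m` times a harmonic polynomial `P` of degree `j ≥ 1` which only depends
on the variables `x'` other than `x₀`. In the coordinates `t = x₀ / |x'|`, `y = x' / |x'|` the
result is `|x'| ^ (m + j) * q t * P y`, where, up to sign and a positive factor, `q` is the `m`-th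
derivative of a negative power of `√(1 + t²)`. Each derivative vanishes at `±∞`, so by Rolle every
differentiation creates one more sign change, and `q` has at least `m + 1` nodal domains. Hence
raising multiplies the number of nodal domains by at least `m + 1`, and the part of each nodal
domain of `P` with large `t` lies in a different nodal domain reaching the north pole. Splitting
`k = m + j` evenly and inducting on the dimension gives both growth rates.
-/

noncomputable section

namespace SphereNodal

open Filter Function Set Topology

section NodalDomains

variable {X Y : Type*} [TopologicalSpace X] [TopologicalSpace Y]

/-- The nodal domain of `f` through the point `x`; it is empty when `f x = 0`. -/
def nodalDomain (f : X → ℝ) (x : X) : Set X :=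
  connectedComponentIn (support f) x

lemma nodalDomains_eq_image (f : X → ℝ) : nodalDomains f = nodalDomain f '' support f := by
  ext Ω
  exact exists_congr fun x => and_congr_right fun _ => eq_comm

lemma nodalDomain_map_eq {g : X → ℝ} {f : Y → ℝ} {φ : X → Y}
    (hφ : ContinuousOn φ (support g)) (hmaps : MapsTo φ (support g) (support f)) {x y : X}
    (hx : x ∈ support g) (hy : y ∈ support g) (h : nodalDomain g x = nodalDomain g y) :
    nodalDomain f (φ x) = nodalDomain f (φ y) := by
  have hyx : y ∈ nodalDomain g x := h ▸ mem_connectedComponentIn hy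
  have himage := hφ.image_connectedComponentIn_subset hx
  have hmono := connectedComponentIn_mono (φ x) hmaps.image_subset
  exact connectedComponentIn_eq (hmono (himage (mem_image_of_mem φ hyx)))

lemma encard_image_le_encard_image {α β γ : Type*} {s : Set α} {f : α → β} {g : α → γ}
    (h : ∀ x ∈ s, ∀ y ∈ s, f x = f y → g x = g y) : (g '' s).encard ≤ (f '' s).encard := by
  have hinj : InjOn Prod.fst ((fun x => (f x, g x)) '' s) := by
    rintro _ ⟨x, hx, rfl⟩ _ ⟨y, hy, rfl⟩ hxy
    exact Prod.ext hxy (h x hx y hy hxy)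
  calc (g '' s).encard = (Prod.snd '' ((fun x => (f x, g x)) '' s)).encard := by rw [image_image]
    _ ≤ ((fun x => (f x, g x)) '' s).encard := encard_image_le _ _
    _ = (Prod.fst '' ((fun x => (f x, g x)) '' s)).encard := hinj.encard_image.symm
    _ = (f '' s).encard := by rw [image_image]

lemma encard_nodalDomains_le_of_image_support {g : X → ℝ} {f : Y → ℝ} {φ : X → Y}
    (hφ : ContinuousOn φ (support g)) (himage : φ '' support g = support f) :
    (nodalDomains f).encard ≤ (nodalDomains g).encard := by
  rw [nodalDomains_eq_image f, nodalDomains_eq_image g, ← himage, image_image]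
  exact encard_image_le_encard_image fun x hx y hy =>
    nodalDomain_map_eq hφ (mapsTo_iff_image_subset.2 himage.subset) hx hy

lemma mul_encard_nodalDomains_le (q : X → ℝ) (f : Y → ℝ) :
    (nodalDomains q).encard * (nodalDomains f).encard ≤
      (nodalDomains fun z : X × Y => q z.1 * f z.2).encard := by
  have hsupp : support (fun z : X × Y => q z.1 * f z.2) = support q ×ˢ support f := by
    ext z
    simp
  rw [← encard_prod]
  simp only [nodalDomains_eq_image, prod_image_image_eq, hsupp]
  refine encard_image_le_encard_image fun z hz w hw h => ?_
  rw [← hsupp] at hz hw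
  have hmaps := hsupp.subset
  exact Prod.ext
    (nodalDomain_map_eq continuousOn_fst (fun _ hv => (hmaps hv).1) hz hw h)
    (nodalDomain_map_eq continuousOn_snd (fun _ hv => (hmaps hv).2) hz hw h)

lemma mem_frontier_nodalDomain {g : X → ℝ} {a : X} (ha : g a = 0) {γ : ℝ → X} {T : ℝ}
    (hγ : ContinuousOn γ (Ici T)) (hsupp : MapsTo γ (Ici T) (support g))
    (hlim : Tendsto γ atTop (𝓝 a)) : a ∈ frontier (nodalDomain g (γ T)) := by
  refine ⟨mem_closure_of_tendsto hlim ?_, fun h => ?_⟩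
  · have hsub : γ '' Ici T ⊆ nodalDomain g (γ T) :=
      (isPreconnected_Ici.image γ hγ).subset_connectedComponentIn
        (mem_image_of_mem γ self_mem_Ici) hsupp.image_subset
    exact (eventually_ge_atTop T).mono fun t ht => hsub (mem_image_of_mem γ ht)
  · exact connectedComponentIn_subset _ _ (interior_subset h) ha

lemma encard_nodalDomains_le_encard_frontier {g : X → ℝ} {f : Y → ℝ} {φ : X → Y}
    (hφ : ContinuousOn φ (support g)) (hmaps : MapsTo φ (support g) (support f))
    {a : X} (ha : g a = 0) {γ : Y → ℝ → X} {T : ℝ}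
    (hγ : ∀ y ∈ support f, ContinuousOn (γ y) (Ici T))
    (hsupp : ∀ y ∈ support f, MapsTo (γ y) (Ici T) (support g))
    (hlim : ∀ y ∈ support f, Tendsto (γ y) atTop (𝓝 a))
    (hsection : ∀ y ∈ support f, φ (γ y T) = y) :
    (nodalDomains f).encard ≤ {Ω ∈ nodalDomains g | a ∈ frontier Ω}.encard := by
  have hT : ∀ y ∈ support f, γ y T ∈ support g := fun y hy => hsupp y hy self_mem_Ici
  calc (nodalDomains f).encard ≤ ((fun y => nodalDomain g (γ y T)) '' support f).encard := by
        rw [nodalDomains_eq_image]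
        refine encard_image_le_encard_image fun y hy z hz h => ?_
        have hφγ := nodalDomain_map_eq hφ hmaps (hT y hy) (hT z hz) h
        rwa [hsection y hy, hsection z hz] at hφγ
    _ ≤ {Ω ∈ nodalDomains g | a ∈ frontier Ω}.encard := by
        refine encard_le_encard (image_subset_iff.2 fun y hy => ⟨⟨γ y T, hT y hy, rfl⟩, ?_⟩)
        exact mem_frontier_nodalDomain ha (hγ y hy) (hsupp y hy) (hlim y hy)

lemma self_mem_nodalDomain_of_mem {f : X → ℝ} {x y : X} (h : y ∈ nodalDomain f x) :
    x ∈ nodalDomain f x :=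
  mem_connectedComponentIn (connectedComponentIn_nonempty_iff.1 ⟨y, h⟩)

lemma mul_pos_of_mem_nodalDomain {f : X → ℝ} (hf : ContinuousOn f (support f)) {x y : X}
    (h : y ∈ nodalDomain f x) : 0 < f x * f y := by
  have hsub : nodalDomain f x ⊆ support f := connectedComponentIn_subset _ _
  have himage := isPreconnected_connectedComponentIn.image f (hf.mono hsub)
  by_contra! hle
  have hzero : (0 : ℝ) ∈ uIcc (f x) (f y) := by
    rcases mul_nonpos_iff.1 hle with ⟨hx, hy⟩ | ⟨hx, hy⟩
    · exact mem_uIcc_of_ge hy hx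
    · exact mem_uIcc_of_le hx hy
  obtain ⟨z, hz, hfz⟩ := himage.ordConnected.uIcc_subset
    (mem_image_of_mem f (self_mem_nodalDomain_of_mem h)) (mem_image_of_mem f h) hzero
  exact hsub hz hfz

lemma Icc_subset_nodalDomain {f : ℝ → ℝ} {s t : ℝ} (h : t ∈ nodalDomain f s) :
    Icc s t ⊆ nodalDomain f s :=
  isPreconnected_connectedComponentIn.Icc_subset (self_mem_nodalDomain_of_mem h) h

end NodalDomains

section Alternation

/-- `f` takes nonzero values of alternating signs at `m + 1` increasing points `u 0, …, u m`; the
factor `ε` fixes the sign of `f (u 0)`. -/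
def Alternates (f : ℝ → ℝ) (m : ℕ) : Prop :=
  ∃ (u : ℕ → ℝ) (ε : ℝ), StrictMonoOn u (Iic m) ∧ ∀ i ≤ m, 0 < ε * (-1) ^ i * f (u i)

namespace Alternates

variable {f : ℝ → ℝ} {m : ℕ}

lemma neg (hf : Alternates f m) : Alternates (-f) m := by
  obtain ⟨u, ε, hu, hsign⟩ := hf
  exact ⟨u, -ε, hu, fun i hi => by simpa using hsign i hi⟩

lemma mul_of_pos (hf : Alternates f m) {w : ℝ → ℝ} (hw : ∀ t, 0 < w t) :
    Alternates (f * w) m := by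
  obtain ⟨u, ε, hu, hsign⟩ := hf
  refine ⟨u, ε, hu, fun i hi => ?_⟩
  rw [Pi.mul_apply, ← mul_assoc]
  exact mul_pos (hsign i hi) (hw _)

lemma ne_zero (hf : Alternates f m) : f ≠ 0 := by
  rintro rfl
  obtain ⟨u, ε, -, hsign⟩ := hf
  simpa using hsign 0 m.zero_le

lemma le_encard_nodalDomains (hf : Alternates f m) (hcont : ContinuousOn f (support f)) :
    ((m + 1 : ℕ) : ℕ∞) ≤ (nodalDomains f).encard := by
  obtain ⟨u, ε, hu, hsign⟩ := hf
  have hsupp : ∀ i ≤ m, u i ∈ support f := fun i hi h => by simpa [h] using hsign i hi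
  have hsucc : ∀ i, i + 1 ≤ m → f (u i) * f (u (i + 1)) ≤ 0 := by
    intro i hi
    have hsigns := mul_pos (hsign i (Nat.le_of_succ_le hi)) (hsign (i + 1) hi)
    rw [pow_succ] at hsigns
    by_contra! hpos
    linarith [mul_nonneg (sq_nonneg (ε * (-1) ^ i)) hpos.le]
  have hne : ∀ i j, i < j → j ≤ m → nodalDomain f (u i) ≠ nodalDomain f (u j) := by
    intro i j hij hj h
    have hi : i + 1 ≤ m := Nat.le_trans hij hj
    have hmem : u j ∈ nodalDomain f (u i) := h ▸ mem_connectedComponentIn (hsupp j hj)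
    have hbetween : u (i + 1) ∈ Icc (u i) (u j) :=
      ⟨(hu (Nat.le_of_succ_le hi) hi i.lt_succ_self).le, hu.monotoneOn hi hj hij⟩
    exact (hsucc i hi).not_gt
      (mul_pos_of_mem_nodalDomain hcont (Icc_subset_nodalDomain hmem hbetween))
  rw [← Set.Nat.encard_range]
  refine encard_le_encard_of_injOn (f := fun i => nodalDomain f (u i))
    (fun i hi => ⟨u i, hsupp i (Nat.lt_succ_iff.1 hi), rfl⟩) fun i hi j hj h => ?_
  rcases lt_trichotomy i j with hij | hij | hij
  · exact (hne i j hij (Nat.lt_succ_iff.1 hj) h).elim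
  · exact hij
  · exact (hne j i hij (Nat.lt_succ_iff.1 hi) h.symm).elim

end Alternates

lemma exists_deriv_pos_of_lt {f : ℝ → ℝ} (hf : Differentiable ℝ f) {x y : ℝ} (hxy : x < y)
    (hlt : f x < f y) : ∃ v ∈ Ioo x y, 0 < deriv f v := by
  obtain ⟨v, hv, hslope⟩ :=
    exists_deriv_eq_slope f hxy hf.continuous.continuousOn hf.differentiableOn
  exact ⟨v, hv, hslope ▸ div_pos (sub_pos.2 hlt) (sub_pos.2 hxy)⟩

lemma exists_deriv_pos_of_tendsto_atBot {f : ℝ → ℝ} (hf : Differentiable ℝ f)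
    (hlim : Tendsto f atBot (𝓝 0)) {x : ℝ} (hx : 0 < f x) : ∃ v < x, 0 < deriv f v := by
  obtain ⟨a, hfa, hax⟩ := ((hlim.eventually_lt_const hx).and (eventually_lt_atBot x)).exists
  obtain ⟨v, hv, hpos⟩ := exists_deriv_pos_of_lt hf hax hfa
  exact ⟨v, hv.2, hpos⟩

lemma exists_deriv_pos_of_tendsto_atTop {f : ℝ → ℝ} (hf : Differentiable ℝ f)
    (hlim : Tendsto f atTop (𝓝 0)) {x : ℝ} (hx : f x < 0) : ∃ v > x, 0 < deriv f v := by
  obtain ⟨b, hfb, hxb⟩ := ((hlim.eventually_const_lt hx).and (eventually_gt_atTop x)).exists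
  obtain ⟨v, hv, hpos⟩ := exists_deriv_pos_of_lt hf hxb hfb
  exact ⟨v, hv.1, hpos⟩

/-- Rolle's theorem, with the limits at `±∞` playing the role of two additional zeros. -/
lemma Alternates.alternates_deriv {f : ℝ → ℝ} {m : ℕ} (hf : Alternates f m)
    (hdiff : Differentiable ℝ f) (hlim : Tendsto f (cocompact ℝ) (𝓝 0)) :
    Alternates (deriv f) (m + 1) := by
  obtain ⟨u, ε, hu, hsign⟩ := hf
  rw [cocompact_eq_atBot_atTop, tendsto_sup] at hlim
  have hexists : ∀ i ≤ m + 1, ∃ v, (∀ l, i = l + 1 → u l < v) ∧ (i ≤ m → v < u i) ∧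
      0 < ε * (-1) ^ i * deriv f v := by
    intro i hi
    let g : ℝ → ℝ := fun t => ε * (-1) ^ i * f t
    have hg : Differentiable ℝ g := hdiff.const_mul _
    have hderiv : ∀ v, deriv g v = ε * (-1) ^ i * deriv f v :=
      fun v => deriv_const_mul _ (hdiff v)
    have hg_pos : i ≤ m → 0 < g (u i) := hsign i
    have hg_neg : ∀ l, i = l + 1 → g (u l) < 0 := by
      rintro l rfl
      have hl := hsign l (by omega)
      simp only [g, pow_succ]
      linarith
    simp only [← hderiv]
    rcases i with _ | l
    · obtain ⟨v, hv, hpos⟩ := exists_deriv_pos_of_tendsto_atBot hg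
        (by simpa using hlim.1.const_mul (ε * (-1) ^ 0)) (hg_pos m.zero_le)
      exact ⟨v, by simp, fun _ => hv, hpos⟩
    · rcases (Nat.succ_le_succ_iff.1 hi).eq_or_lt with rfl | hlt
      · obtain ⟨v, hv, hpos⟩ := exists_deriv_pos_of_tendsto_atTop hg
          (by simpa using hlim.2.const_mul (ε * (-1) ^ (l + 1))) (hg_neg l rfl)
        exact ⟨v, by simpa using hv, by simp, hpos⟩
      · obtain ⟨v, hv, hpos⟩ := exists_deriv_pos_of_lt hg (hu hlt.le hlt l.lt_succ_self)
          ((hg_neg l rfl).trans (hg_pos hlt))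
        exact ⟨v, by simpa using hv.1, fun _ => hv.2, hpos⟩
  choose! v hright hleft hpos using hexists
  refine ⟨v, ε, strictMonoOn_of_lt_add_one ordConnected_Iic fun i _ hi hi' => ?_, hpos⟩
  exact (hleft i hi (Nat.succ_le_succ_iff.1 hi')).trans (hright (i + 1) hi' i rfl)

end Alternation

section Profiles

open Polynomial

/-- The restriction of the Kelvin transform of a homogeneous polynomial to a line at distance `1`
from the origin, parametrized by arc length from the point nearest to the origin. If `F` is
homogeneous of degree `d` in `N` variables and `q` is its restriction to that line, then
`F / |x| ^ (2 * d + N - 2)` restricts to `kelvinProfile (2 * d + N - 2) q`. -/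
def kelvinProfile (c : ℕ) (q : ℝ[X]) (t : ℝ) : ℝ :=
  q.eval t / √(1 + t ^ 2) ^ c

/-- The effect on `q` of differentiating `kelvinProfile c q`, up to sign and with `c` increased
by `2`. -/
def raiseProfile (c : ℕ) (q : ℝ[X]) : ℝ[X] :=
  C (c : ℝ) * (X * q) - (1 + X ^ 2) * derivative q

lemma sqrt_one_add_sq_pos (t : ℝ) : 0 < √(1 + t ^ 2) :=
  Real.sqrt_pos.2 (by positivity)

lemma hasDerivAt_kelvinProfile (c : ℕ) (q : ℝ[X]) (t : ℝ) :
    HasDerivAt (kelvinProfile c q) (-kelvinProfile (c + 2) (raiseProfile c q) t) t := by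
  have hpos : 0 < 1 + t ^ 2 := by positivity
  have hsqrt := sqrt_one_add_sq_pos t
  have hbase : HasDerivAt (fun t : ℝ => 1 + t ^ 2) (2 * t) t := by
    simpa using (hasDerivAt_pow 2 t).const_add 1
  have hquot := (q.hasDerivAt t).div ((hbase.sqrt hpos.ne').pow c) (pow_pos hsqrt c).ne'
  refine hquot.congr_deriv ?_
  simp only [kelvinProfile, raiseProfile, eval_sub, eval_mul, eval_C, eval_X, eval_add, eval_one,
    eval_pow, Pi.pow_apply]
  rw [← Real.sq_sqrt hpos.le, Real.sqrt_sq hsqrt.le]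
  generalize √(1 + t ^ 2) = r at hsqrt
  rcases c with _ | c
  · simp
    field_simp
  · rw [Nat.add_sub_cancel]
    field_simp
    ring

lemma deriv_kelvinProfile (c : ℕ) (q : ℝ[X]) :
    deriv (kelvinProfile c q) = -kelvinProfile (c + 2) (raiseProfile c q) :=
  funext fun t => (hasDerivAt_kelvinProfile c q t).deriv

lemma tendsto_kelvinProfile_cocompact {c : ℕ} {q : ℝ[X]} (hq : q.natDegree < c) :
    Tendsto (kelvinProfile c q) (cocompact ℝ) (𝓝 0) := by
  have hdegree : (q ^ 2).degree < ((1 + X ^ 2 : ℝ[X]) ^ c).degree := by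
    have hbase : (1 + X ^ 2 : ℝ[X]).natDegree = 2 := by compute_degree!
    apply degree_lt_degree
    rw [natDegree_pow, natDegree_pow, hbase]
    omega
  have hsq : Tendsto (fun t => (q ^ 2).eval t / ((1 + X ^ 2) ^ c).eval t) (cocompact ℝ) (𝓝 0) := by
    rw [cocompact_eq_atBot_atTop]
    exact (div_tendsto_atBot_zero_of_degree_lt _ _ hdegree).sup
      (div_tendsto_atTop_zero_of_degree_lt _ _ hdegree)
  refine (tendsto_zero_iff_abs_tendsto_zero _).2 ((Real.sqrt_zero ▸ hsq.sqrt).congr fun t => ?_)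
  have habs : (q ^ 2).eval t / ((1 + X ^ 2) ^ c).eval t = kelvinProfile c q t ^ 2 := by
    have hpos : 0 ≤ 1 + t ^ 2 := by positivity
    simp only [kelvinProfile, eval_pow, eval_add, eval_one, eval_X, div_pow]
    rw [pow_right_comm, Real.sq_sqrt hpos]
  rw [habs, Real.sqrt_sq_eq_abs, comp_apply]

lemma alternates_kelvinProfile_iff {c : ℕ} {q : ℝ[X]} {m : ℕ} :
    Alternates (kelvinProfile c q) m ↔ Alternates q.eval m := by
  have hweight : ∀ t : ℝ, 0 < √(1 + t ^ 2) ^ c := fun t => pow_pos (sqrt_one_add_sq_pos t) c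
  refine ⟨fun h => ?_, fun h => h.mul_of_pos fun t => inv_pos.2 (hweight t)⟩
  convert! h.mul_of_pos hweight using 1
  exact funext fun t => (div_mul_cancel₀ _ (hweight t).ne').symm

lemma Alternates.raiseProfile {c : ℕ} {q : ℝ[X]} {m : ℕ} (hq : Alternates q.eval m)
    (hc : q.natDegree < c) : Alternates (raiseProfile c q).eval (m + 1) := by
  have hdiff : Differentiable ℝ (kelvinProfile c q) :=
    fun t => (hasDerivAt_kelvinProfile c q t).differentiableAt
  have hderiv := (alternates_kelvinProfile_iff.2 hq).alternates_deriv hdiff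
    (tendsto_kelvinProfile_cocompact hc)
  rw [deriv_kelvinProfile] at hderiv
  exact alternates_kelvinProfile_iff.1 (neg_neg (kelvinProfile _ _) ▸ hderiv.neg)

lemma natDegree_raiseProfile_le (c : ℕ) (q : ℝ[X]) :
    (raiseProfile c q).natDegree ≤ q.natDegree + 1 := by
  have hbase : (1 + X ^ 2 : ℝ[X]).natDegree ≤ 2 := by compute_degree
  refine (natDegree_sub_le _ _).trans (max_le ?_ ?_)
  · refine (natDegree_C_mul_le _ _).trans (natDegree_mul_le.trans ?_)
    rw [natDegree_X, add_comm]
  · rcases eq_or_ne q.natDegree 0 with hconst | hconst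
    · rw [eq_C_of_natDegree_eq_zero hconst, derivative_C, mul_zero, natDegree_zero]
      exact Nat.zero_le _
    · have hderiv := natDegree_derivative_lt hconst
      exact natDegree_mul_le.trans (by omega)

/-- The result of raising the constant profile `m` times, starting with exponent `c`. Up to
sign, `kelvinProfile (c + 2 * m) (profile c m)` is the `m`-th derivative of `√(1 + t ^ 2)⁻¹ ^ c`. -/
def profile (c : ℕ) : ℕ → ℝ[X]
  | 0 => 1
  | m + 1 => raiseProfile (c + 2 * m) (profile c m)

lemma natDegree_profile_le (c m : ℕ) : (profile c m).natDegree ≤ m := by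
  induction m with
  | zero => exact natDegree_one.le
  | succ m ih => exact (natDegree_raiseProfile_le _ _).trans (Nat.succ_le_succ ih)

lemma alternates_profile {c : ℕ} (hc : c ≠ 0) (m : ℕ) : Alternates (profile c m).eval m := by
  induction m with
  | zero =>
    exact ⟨fun _ => 0, 1, fun _ _ _ hj hij => absurd (hij.trans_le hj) (Nat.not_lt_zero _),
      by simp [profile]⟩
  | succ m ih =>
    have hdegree := natDegree_profile_le c m
    exact ih.raiseProfile (by omega)

end Profiles

section HarmonicPolynomials

open MvPolynomial

variable {n d : ℕ}

/-- The square of the Euclidean norm, as a polynomial. -/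
def normSqPoly (n : ℕ) : MvPolynomial (Fin (n + 1)) ℝ :=
  ∑ i, X i ^ 2

lemma normSqPoly_isHomogeneous (n : ℕ) : (normSqPoly n).IsHomogeneous 2 :=
  IsHomogeneous.sum _ _ _ fun i _ => isHomogeneous_X_pow i 2

lemma pderiv_normSqPoly (i : Fin (n + 1)) : pderiv i (normSqPoly n) = 2 * X i := by
  simp [normSqPoly, pderiv_X, Pi.single_apply]

lemma pderiv_pderiv_comm {σ R : Type*} [CommRing R] (i j : σ) (F : MvPolynomial σ R) :
    pderiv i (pderiv j F) = pderiv j (pderiv i F) := by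
  classical
  let D (l : σ) : Derivation R (MvPolynomial σ R) (MvPolynomial σ R) := pderiv l
  have hbracket : ⁅D i, D j⁆ = 0 := derivation_ext fun k => by
    simp [D, Derivation.commutator_apply, pderiv_X, Pi.single_apply, apply_ite]
  simpa [D, Derivation.commutator_apply, sub_eq_zero] using congrArg (fun E => E F) hbracket

lemma polyLaplacian_apply (F : MvPolynomial (Fin (n + 1)) ℝ) :
    polyLaplacian n F = ∑ i, pderiv i (pderiv i F) := by
  simp [polyLaplacian]

lemma mem_harmonicPolynomials {F : MvPolynomial (Fin (n + 1)) ℝ} :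
    F ∈ harmonicPolynomials n d ↔ F.IsHomogeneous d ∧ polyLaplacian n F = 0 :=
  Iff.rfl

lemma polyLaplacian_pderiv (i : Fin (n + 1)) (F : MvPolynomial (Fin (n + 1)) ℝ) :
    polyLaplacian n (pderiv i F) = pderiv i (polyLaplacian n F) := by
  simp only [polyLaplacian_apply, map_sum, pderiv_pderiv_comm _ i]

lemma polyLaplacian_X_mul (i : Fin (n + 1)) (F : MvPolynomial (Fin (n + 1)) ℝ) :
    polyLaplacian n (X i * F) = (2 : ℝ) • pderiv i F + X i * polyLaplacian n F := by
  have hterm : ∀ l, pderiv l (pderiv l (X i * F)) =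
      (if l = i then (2 : ℝ) • pderiv i F else 0) + X i * pderiv l (pderiv l F) := by
    intro l
    split_ifs with hl
    · subst hl
      simp [two_smul]
      ring
    · simp [pderiv_X_of_ne (Ne.symm hl)]
  simp only [polyLaplacian_apply, hterm, Finset.sum_add_distrib, Finset.sum_ite_eq',
    Finset.mem_univ, if_true, Finset.mul_sum]

lemma polyLaplacian_normSqPoly_mul (F : MvPolynomial (Fin (n + 1)) ℝ) :
    polyLaplacian n (normSqPoly n * F) =
      (2 * (n + 1) : ℝ) • F + (4 : ℝ) • ∑ i, X i * pderiv i F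
        + normSqPoly n * polyLaplacian n F := by
  have hterm : ∀ i, pderiv i (pderiv i (normSqPoly n * F)) =
      (2 : ℝ) • F + (4 : ℝ) • (X i * pderiv i F) + normSqPoly n * pderiv i (pderiv i F) := by
    intro i
    have htwo : pderiv i (2 : MvPolynomial (Fin (n + 1)) ℝ) = 0 := Derivation.map_natCast _ 2
    simp [pderiv_normSqPoly, htwo, ofNat_smul_eq_nsmul]
    ring
  simp only [polyLaplacian_apply, hterm, Finset.sum_add_distrib, ← Finset.mul_sum,
    ← Finset.smul_sum, Finset.sum_const, Finset.card_univ, Fintype.card_fin]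
  module

/-- The raising operator `F ↦ (2 d + N - 2) xᵢ F - |x|² ∂ᵢ F` on homogeneous polynomials of degree
`d` in `N = n + 1` variables. It is the conjugate of `-∂ᵢ` by the Kelvin transform
`F ↦ F / |x| ^ (2 d + N - 2)`, hence preserves harmonicity. -/
def raising (d : ℕ) (i : Fin (n + 1)) (F : MvPolynomial (Fin (n + 1)) ℝ) :
    MvPolynomial (Fin (n + 1)) ℝ :=
  (2 * d + n - 1 : ℝ) • (X i * F) - normSqPoly n * pderiv i F

lemma pderiv_eq_zero_of_isHomogeneous_zero {σ R : Type*} [CommSemiring R] {F : MvPolynomial σ R}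
    (hF : F.IsHomogeneous 0) (i : σ) : pderiv i F = 0 := by
  rw [totalDegree_eq_zero_iff_eq_C.1 ((totalDegree_zero_iff_isHomogeneous _).2 hF), pderiv_C]

lemma isHomogeneous_raising (i : Fin (n + 1)) {F : MvPolynomial (Fin (n + 1)) ℝ}
    (hF : F.IsHomogeneous d) : (raising d i F).IsHomogeneous (d + 1) := by
  have hleft : (X i * F).IsHomogeneous (d + 1) := add_comm 1 d ▸ (isHomogeneous_X ℝ i).mul hF
  have hright : (normSqPoly n * pderiv i F).IsHomogeneous (d + 1) := by
    rcases d with _ | d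
    · rw [pderiv_eq_zero_of_isHomogeneous_zero hF, mul_zero]
      exact isHomogeneous_zero _ _ _
    · exact add_comm 2 d ▸ (normSqPoly_isHomogeneous n).mul hF.pderiv
  exact Submodule.sub_mem (homogeneousSubmodule _ ℝ (d + 1)) (Submodule.smul_mem _ _ hleft) hright

lemma polyLaplacian_raising (i : Fin (n + 1)) {F : MvPolynomial (Fin (n + 1)) ℝ}
    (hF : F ∈ harmonicPolynomials n d) : polyLaplacian n (raising d i F) = 0 := by
  obtain ⟨hhom, hharm⟩ := mem_harmonicPolynomials.1 hF
  have heuler : ∑ l, X l * pderiv l (pderiv i F) = (d - 1 : ℝ) • pderiv i F := by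
    rcases d with _ | d
    · simp [pderiv_eq_zero_of_isHomogeneous_zero hhom]
    · rw [hhom.pderiv.sum_X_mul_pderiv, ← Nat.cast_smul_eq_nsmul ℝ]
      simp
  rw [raising, map_sub, map_smul, polyLaplacian_X_mul, polyLaplacian_normSqPoly_mul,
    polyLaplacian_pderiv, hharm, heuler, map_zero, mul_zero, mul_zero]
  module

lemma raising_mem_harmonicPolynomials (i : Fin (n + 1)) {F : MvPolynomial (Fin (n + 1)) ℝ}
    (hF : F ∈ harmonicPolynomials n d) : raising d i F ∈ harmonicPolynomials n (d + 1) :=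
  mem_harmonicPolynomials.2 ⟨isHomogeneous_raising i hF.1, polyLaplacian_raising i hF⟩

lemma polyLaplacian_rename_succ (P : MvPolynomial (Fin (n + 1)) ℝ) :
    polyLaplacian (n + 1) (rename Fin.succ P) = rename Fin.succ (polyLaplacian n P) := by
  have hzero : pderiv 0 (rename Fin.succ P) = 0 := by
    refine pderiv_eq_zero_of_notMem_vars fun h => ?_
    obtain ⟨i, -, hi⟩ := Finset.mem_image.1 (vars_rename _ _ h)
    exact Fin.succ_ne_zero _ hi
  simp only [polyLaplacian_apply, Fin.sum_univ_succ (n := n + 1), hzero, map_zero, zero_add,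
    pderiv_rename (Fin.succ_injective _), map_sum]

/-- The polynomial of degree `m + j` in one more variable `x₀`, obtained from a polynomial `P` of
degree `j` by raising it `m` times in the direction of `x₀`. -/
def harmonicLift (j : ℕ) (P : MvPolynomial (Fin (n + 1)) ℝ) : ℕ → MvPolynomial (Fin (n + 2)) ℝ
  | 0 => rename Fin.succ P
  | m + 1 => raising (m + j) 0 (harmonicLift j P m)

lemma harmonicLift_mem_harmonicPolynomials {j : ℕ} {P : MvPolynomial (Fin (n + 1)) ℝ}
    (hP : P ∈ harmonicPolynomials n j) (m : ℕ) :
    harmonicLift j P m ∈ harmonicPolynomials (n + 1) (m + j) := by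
  induction m with
  | zero =>
    obtain ⟨hhom, hharm⟩ := mem_harmonicPolynomials.1 hP
    rw [zero_add]
    exact ⟨hhom.rename_isHomogeneous,
      LinearMap.mem_ker.2 (by rw [harmonicLift, polyLaplacian_rename_succ, hharm, map_zero])⟩
  | succ m ih => exact add_right_comm m j 1 ▸ raising_mem_harmonicPolynomials 0 ih

/-- Restriction of a polynomial to the line through `(0, y)` in the direction of `x₀`. -/
def lineRestrict (y : Fin n → ℝ) : MvPolynomial (Fin (n + 1)) ℝ →ₐ[ℝ] Polynomial ℝ :=
  aeval (Fin.cons Polynomial.X fun i => Polynomial.C (y i))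

lemma eval_lineRestrict (y : Fin n → ℝ) (F : MvPolynomial (Fin (n + 1)) ℝ) (t : ℝ) :
    (lineRestrict y F).eval t = eval (Fin.cons t y) F := by
  induction F using MvPolynomial.induction_on with
  | C a => simp [lineRestrict]
  | add F G hF hG => simp [hF, hG]
  | mul_X F i hF =>
    rw [map_mul, Polynomial.eval_mul, hF, map_mul]
    cases i using Fin.cases <;> simp [lineRestrict]

lemma derivative_lineRestrict (y : Fin n → ℝ) (F : MvPolynomial (Fin (n + 1)) ℝ) :
    Polynomial.derivative (lineRestrict y F) = lineRestrict y (pderiv 0 F) := by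
  induction F using MvPolynomial.induction_on with
  | C a => simp [lineRestrict]
  | add F G hF hG => simp [hF, hG]
  | mul_X F i hF =>
    rw [map_mul, Polynomial.derivative_mul, hF, Derivation.leibniz]
    cases i using Fin.cases <;> simp [lineRestrict] <;> ring

lemma lineRestrict_normSqPoly (y : Fin (n + 1) → ℝ) :
    lineRestrict y (normSqPoly (n + 1)) = Polynomial.C (∑ i, y i ^ 2) + Polynomial.X ^ 2 := by
  simp [normSqPoly, lineRestrict, Fin.sum_univ_succ (n := n + 1), add_comm]

lemma lineRestrict_raising (d : ℕ) (y : Fin (n + 1) → ℝ) (F : MvPolynomial (Fin (n + 2)) ℝ) :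
    lineRestrict y (raising d 0 F) =
      Polynomial.C ((2 * d + n : ℕ) : ℝ) * (Polynomial.X * lineRestrict y F)
        - (Polynomial.C (∑ i, y i ^ 2) + Polynomial.X ^ 2)
          * Polynomial.derivative (lineRestrict y F) := by
  have hX : lineRestrict y (X 0) = Polynomial.X := by simp [lineRestrict]
  have hcoeff : (2 * d + (n + 1 : ℕ) - 1 : ℝ) = (2 * d + n : ℕ) := by push_cast; ring
  rw [raising, map_sub, map_smul, map_mul, map_mul, hX, lineRestrict_normSqPoly,
    ← derivative_lineRestrict, hcoeff, Polynomial.smul_eq_C_mul]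

lemma lineRestrict_harmonicLift (j : ℕ) (P : MvPolynomial (Fin (n + 1)) ℝ) {y : Fin (n + 1) → ℝ}
    (hy : ∑ i, y i ^ 2 = 1) (m : ℕ) :
    lineRestrict y (harmonicLift j P m) =
      Polynomial.C (eval y P) * profile (2 * j + n) m := by
  induction m with
  | zero =>
    refine Polynomial.funext fun t => ?_
    simp [eval_lineRestrict, harmonicLift, profile, eval_rename, Function.comp_def]
  | succ m ih =>
    have hexponent : 2 * (m + j) + n = 2 * j + n + 2 * m := by ring
    rw [harmonicLift, profile, lineRestrict_raising, ih, hy, hexponent, raiseProfile,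
      Polynomial.derivative_C_mul, Polynomial.C_1]
    ring

lemma lineRestrict_harmonicLift_eq_zero (j : ℕ) {P : MvPolynomial (Fin (n + 1)) ℝ}
    {y : Fin (n + 1) → ℝ} (hP : eval y P = 0) (m : ℕ) :
    lineRestrict y (harmonicLift j P m) = 0 := by
  induction m with
  | zero =>
    refine Polynomial.funext fun t => ?_
    simpa [eval_lineRestrict, harmonicLift, eval_rename, Function.comp_def] using hP
  | succ m ih => simp [harmonicLift, lineRestrict_raising, ih]

lemma eval_smul_of_isHomogeneous {σ R : Type*} [CommSemiring R] {p : MvPolynomial σ R}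
    (hp : p.IsHomogeneous d) (r : R) (x : σ → R) : eval (r • x) p = r ^ d * eval x p := by
  rw [eval_eq, eval_eq, Finset.mul_sum]
  refine Finset.sum_congr rfl fun s hs => ?_
  have hdegree : ∑ i ∈ s.support, s i = d := (hp.degree_eq_sum_deg_support hs).symm
  simp only [Pi.smul_apply, smul_eq_mul, mul_pow, Finset.prod_mul_distrib,
    Finset.prod_pow_eq_pow_sum, hdegree]
  ring

end HarmonicPolynomials

section SphereCoordinates

variable {n : ℕ}

/-- The orthogonal projection of `ℝ^{n+2}` onto the equatorial hyperplane `x₀ = 0`. -/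
def tail (x : Ambient (n + 1)) : Ambient n :=
  WithLp.toLp 2 fun i => x i.succ

lemma continuous_tail : Continuous (tail : Ambient (n + 1) → Ambient n) := by
  unfold tail
  fun_prop

lemma sum_sq_eq_one (y : Sph n) : ∑ i, (y : Ambient n) i ^ 2 = 1 := by
  rw [← EuclideanSpace.real_norm_sq_eq, norm_eq_of_mem_sphere, one_pow]

lemma tail_northPole : tail (northPole (n + 1) : Ambient (n + 1)) = 0 := by
  ext i
  simp [tail, northPole]

/-- The coordinates `(x₀ / |x'|, x' / |x'|)` of the point `x = (x₀, x')` of the sphere away from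
the poles. At the poles the second coordinate is given the junk value `northPole n`. -/
def sphereCoords (x : Sph (n + 1)) : ℝ × Sph n :=
  ((x : Ambient (n + 1)) 0 / ‖tail (x : Ambient (n + 1))‖,
    if hx : tail (x : Ambient (n + 1)) = 0 then northPole n
    else ⟨‖tail (x : Ambient (n + 1))‖⁻¹ • tail x, by simp [norm_smul, hx]⟩)

lemma coe_snd_sphereCoords {x : Sph (n + 1)} (hx : tail (x : Ambient (n + 1)) ≠ 0) :
    ((sphereCoords x).2 : Ambient n) = ‖tail (x : Ambient (n + 1))‖⁻¹ • tail x := by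
  simp [sphereCoords, hx]

lemma continuousOn_sphereCoords :
    ContinuousOn (sphereCoords (n := n)) {x | tail (x : Ambient (n + 1)) ≠ 0} := by
  have htail : Continuous fun x : Sph (n + 1) => tail (x : Ambient (n + 1)) :=
    continuous_tail.comp continuous_subtype_val
  have hcoord : Continuous fun x : Sph (n + 1) => (x : Ambient (n + 1)) 0 := by fun_prop
  refine ContinuousOn.prodMk
    (hcoord.continuousOn.div htail.norm.continuousOn fun x hx => norm_ne_zero_iff.2 hx) ?_
  refine IsInducing.subtypeVal.continuousOn_iff.2 (ContinuousOn.congr ?_ fun x hx =>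
    coe_snd_sphereCoords hx)
  exact (htail.norm.continuousOn.inv₀ fun x hx => norm_ne_zero_iff.2 hx).smul htail.continuousOn

/-- The point of the meridian through the equatorial point `y` whose latitude has tangent `t`. -/
def meridian (y : Sph n) (t : ℝ) : Sph (n + 1) :=
  ⟨WithLp.toLp 2 (Fin.cons (Real.sin (Real.arctan t))
      fun i => Real.cos (Real.arctan t) * (y : Ambient n) i), by
    rw [mem_sphere_zero_iff_norm, EuclideanSpace.norm_eq, Real.sqrt_eq_one, Fin.sum_univ_succ]
    simp only [Fin.cons_zero, Fin.cons_succ, Real.norm_eq_abs, sq_abs, mul_pow, ← Finset.mul_sum,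
      sum_sq_eq_one, mul_one, Real.sin_sq_add_cos_sq]⟩

lemma tail_meridian (y : Sph n) (t : ℝ) :
    tail (meridian y t : Ambient (n + 1)) = Real.cos (Real.arctan t) • (y : Ambient n) :=
  rfl

lemma norm_tail_meridian (y : Sph n) (t : ℝ) :
    ‖tail (meridian y t : Ambient (n + 1))‖ = Real.cos (Real.arctan t) := by
  rw [tail_meridian, norm_smul, norm_eq_of_mem_sphere, mul_one, Real.norm_eq_abs,
    abs_of_pos (Real.cos_arctan_pos t)]

lemma tail_meridian_ne_zero (y : Sph n) (t : ℝ) :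
    tail (meridian y t : Ambient (n + 1)) ≠ 0 :=
  norm_pos_iff.1 (norm_tail_meridian y t ▸ Real.cos_arctan_pos t)

lemma sphereCoords_meridian (y : Sph n) (t : ℝ) : sphereCoords (meridian y t) = (t, y) := by
  refine Prod.ext ?_ (Subtype.ext ?_)
  · change Real.sin (Real.arctan t) / ‖tail (meridian y t : Ambient (n + 1))‖ = t
    rw [norm_tail_meridian, ← Real.tan_eq_sin_div_cos, Real.tan_arctan]
  · rw [coe_snd_sphereCoords (tail_meridian_ne_zero y t), norm_tail_meridian, tail_meridian,
      inv_smul_smul₀ (Real.cos_arctan_pos t).ne']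

lemma image_sphereCoords_inter_preimage (s : Set (ℝ × Sph n)) :
    sphereCoords '' ({x | tail (x : Ambient (n + 1)) ≠ 0} ∩ sphereCoords ⁻¹' s) = s := by
  refine (image_subset_iff.2 inter_subset_right).antisymm fun z hz => ?_
  have hcoords := sphereCoords_meridian z.2 z.1
  exact ⟨meridian z.2 z.1, ⟨tail_meridian_ne_zero _ _, mem_preimage.2 (hcoords ▸ hz)⟩, hcoords⟩

lemma continuous_meridian (y : Sph n) : Continuous (meridian y) := by
  refine Continuous.subtype_mk ((PiLp.continuous_toLp 2 _).comp (continuous_pi fun i => ?_)) _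
  cases i using Fin.cases <;> simp only [Fin.cons_zero, Fin.cons_succ] <;> fun_prop

lemma tendsto_meridian_atTop (y : Sph n) :
    Tendsto (meridian y) atTop (𝓝 (northPole (n + 1))) := by
  have harctan := Real.tendsto_arctan_atTop.mono_right (nhdsWithin_le_nhds)
  have hsin := (Real.continuous_sin.tendsto _).comp harctan
  have hcos := (Real.continuous_cos.tendsto _).comp harctan
  rw [Real.sin_pi_div_two] at hsin
  rw [Real.cos_pi_div_two] at hcos
  refine tendsto_subtype_rng.2 ((PiLp.continuous_toLp 2 _).tendsto _ |>.comp
    (tendsto_pi_nhds.2 fun i => ?_))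
  cases i using Fin.cases with
  | zero => simpa [Function.comp_def] using hsin
  | succ i => simpa using hcos.mul_const ((y : Ambient n) i)

end SphereCoordinates

section LiftedNodalDomains

variable {n j : ℕ} {P : MvPolynomial (Fin (n + 1)) ℝ}

lemma restrictToSphere_apply (F : MvPolynomial (Fin (n + 1)) ℝ) (x : Sph n) :
    restrictToSphere n F x = MvPolynomial.eval (fun i => (x : Ambient n) i) F :=
  rfl

lemma restrictToSphere_harmonicLift (hP : P ∈ harmonicPolynomials n j) (m : ℕ) {x : Sph (n + 1)}
    (hx : tail (x : Ambient (n + 1)) ≠ 0) :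
    restrictToSphere (n + 1) (harmonicLift j P m) x =
      ‖tail (x : Ambient (n + 1))‖ ^ (m + j) *
        ((profile (2 * j + n) m).eval (sphereCoords x).1 *
          restrictToSphere n P (sphereCoords x).2) := by
  set r := ‖tail (x : Ambient (n + 1))‖ with hr
  set y : Fin (n + 1) → ℝ := fun i => ((sphereCoords x).2 : Ambient n) i with hy
  have hr0 : r ≠ 0 := norm_ne_zero_iff.2 hx
  have hpoint : (fun i => (x : Ambient (n + 1)) i) =
      r • (Fin.cons (sphereCoords x).1 y : Fin (n + 2) → ℝ) := by
    ext i
    cases i using Fin.cases with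
    | zero => simp [sphereCoords, ← hr, mul_div_cancel₀ _ hr0]
    | succ i =>
      simp only [hy, coe_snd_sphereCoords hx, ← hr, Pi.smul_apply, Fin.cons_succ,
        PiLp.smul_apply, smul_eq_mul, mul_inv_cancel_left₀ hr0]
      rfl
  rw [restrictToSphere_apply, hpoint,
    eval_smul_of_isHomogeneous (harmonicLift_mem_harmonicPolynomials hP m).1,
    ← eval_lineRestrict, lineRestrict_harmonicLift j P (sum_sq_eq_one _), Polynomial.eval_mul,
    Polynomial.eval_C, mul_comm (MvPolynomial.eval y P), restrictToSphere_apply]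

lemma restrictToSphere_harmonicLift_eq_zero (hP : P ∈ harmonicPolynomials n j) (hj : j ≠ 0)
    (m : ℕ) {x : Sph (n + 1)} (hx : tail (x : Ambient (n + 1)) = 0) :
    restrictToSphere (n + 1) (harmonicLift j P m) x = 0 := by
  have hpoint : (fun i => (x : Ambient (n + 1)) i) =
      (Fin.cons ((x : Ambient (n + 1)) 0) (0 : Fin (n + 1) → ℝ) : Fin (n + 2) → ℝ) := by
    ext i
    cases i using Fin.cases with
    | zero => rfl
    | succ i => exact congrArg (fun v : Ambient n => v i) hx
  have hzero : MvPolynomial.eval (0 : Fin (n + 1) → ℝ) P = 0 := by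
    simpa [hj] using eval_smul_of_isHomogeneous hP.1 0 (0 : Fin (n + 1) → ℝ)
  rw [restrictToSphere_apply, hpoint, ← eval_lineRestrict,
    lineRestrict_harmonicLift_eq_zero j hzero, Polynomial.eval_zero]

lemma support_restrictToSphere_harmonicLift (hP : P ∈ harmonicPolynomials n j) (hj : j ≠ 0)
    (m : ℕ) :
    support (restrictToSphere (n + 1) (harmonicLift j P m)) =
      {x : Sph (n + 1) | tail (x : Ambient (n + 1)) ≠ 0} ∩
        sphereCoords ⁻¹' support fun z : ℝ × Sph n =>
          (profile (2 * j + n) m).eval z.1 * restrictToSphere n P z.2 := by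
  ext x
  by_cases hx : tail (x : Ambient (n + 1)) = 0
  · simp [restrictToSphere_harmonicLift_eq_zero hP hj m hx, hx]
  · simp [restrictToSphere_harmonicLift hP m hx, hx]

lemma continuousOn_sphereCoords_support (hP : P ∈ harmonicPolynomials n j) (hj : j ≠ 0) (m : ℕ) :
    ContinuousOn sphereCoords (support (restrictToSphere (n + 1) (harmonicLift j P m))) :=
  continuousOn_sphereCoords.mono <|
    (support_restrictToSphere_harmonicLift hP hj m).trans_subset inter_subset_left

lemma mul_encard_nodalDomains_le_harmonicLift (hP : P ∈ harmonicPolynomials n j) (hj : j ≠ 0)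
    (m : ℕ) :
    ((m + 1 : ℕ) : ℕ∞) * (nodalDomains (restrictToSphere n P)).encard ≤
      (nodalDomains (restrictToSphere (n + 1) (harmonicLift j P m))).encard := by
  set q := profile (2 * j + n) m
  have hq_domains : ((m + 1 : ℕ) : ℕ∞) ≤ (nodalDomains q.eval).encard :=
    (alternates_profile (by omega) m).le_encard_nodalDomains q.continuous.continuousOn
  calc ((m + 1 : ℕ) : ℕ∞) * (nodalDomains (restrictToSphere n P)).encard
      ≤ (nodalDomains q.eval).encard * (nodalDomains (restrictToSphere n P)).encard := by gcongr
    _ ≤ (nodalDomains fun z : ℝ × Sph n => q.eval z.1 * restrictToSphere n P z.2).encard :=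
        mul_encard_nodalDomains_le _ _
    _ ≤ _ := by
        refine encard_nodalDomains_le_of_image_support
          (continuousOn_sphereCoords_support hP hj m) ?_
        rw [support_restrictToSphere_harmonicLift hP hj, image_sphereCoords_inter_preimage]

lemma encard_nodalDomains_le_frontier_harmonicLift (hP : P ∈ harmonicPolynomials n j)
    (hj : j ≠ 0) (m : ℕ) :
    (nodalDomains (restrictToSphere n P)).encard ≤
      {Ω ∈ nodalDomains (restrictToSphere (n + 1) (harmonicLift j P m)) |
        northPole (n + 1) ∈ frontier Ω}.encard := by
  have hq : profile (2 * j + n) m ≠ 0 := fun h =>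
    (alternates_profile (c := 2 * j + n) (by omega) m).ne_zero (funext fun t => by simp [h])
  obtain ⟨T, hT⟩ := eventually_atTop.1 (Polynomial.eventually_atTop_not_isRoot _ hq)
  have hsupp := support_restrictToSphere_harmonicLift hP hj m
  refine encard_nodalDomains_le_encard_frontier (γ := meridian) (T := T)
    (continuous_snd.comp_continuousOn (continuousOn_sphereCoords_support hP hj m))
    (fun x hx => right_ne_zero_of_mul (hsupp.subset hx).2)
    (restrictToSphere_harmonicLift_eq_zero hP hj m tail_northPole)
    (fun y _ => (continuous_meridian y).continuousOn)
    (fun y hy t ht => hsupp.superset ⟨tail_meridian_ne_zero y t, ?_⟩)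
    (fun y _ => tendsto_meridian_atTop y)
    (fun y _ => congrArg Prod.snd (sphereCoords_meridian y T))
  rw [mem_preimage, sphereCoords_meridian]
  exact mul_ne_zero (hT t ht) hy

end LiftedNodalDomains

section Counting

variable {n j k m C : ℕ} {P : MvPolynomial (Fin (n + 1)) ℝ}

lemma X_mem_harmonicPolynomials (i : Fin (n + 1)) : MvPolynomial.X i ∈ harmonicPolynomials n 1 :=
  ⟨MvPolynomial.isHomogeneous_X ℝ i, LinearMap.mem_ker.2 <| by
    simp [polyLaplacian_apply, MvPolynomial.pderiv_X, Pi.single_apply, apply_ite]⟩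

lemma one_le_encard_nodalDomains {X : Type*} [TopologicalSpace X] {f : X → ℝ} (hf : f ≠ 0) :
    1 ≤ (nodalDomains f).encard := by
  obtain ⟨x, hx⟩ := Function.ne_iff.1 hf
  exact one_le_encard_iff_nonempty.2 ⟨_, x, hx, rfl⟩

lemma restrictToSphere_X_zero_ne_zero (n : ℕ) :
    restrictToSphere n (MvPolynomial.X 0) ≠ 0 := fun h => by
  simpa [restrictToSphere_apply, northPole] using congrFun h (northPole n)

lemma pow_succ_le_encard_harmonicLift (hP : P ∈ harmonicPolynomials n j) (hj : j ≠ 0)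
    (hkm : k ≤ C * (m + 1))
    (hcount : (k : ℕ∞) ^ n ≤ C * (nodalDomains (restrictToSphere n P)).encard) :
    (k : ℕ∞) ^ (n + 1) ≤ ((C ^ 2 : ℕ) : ℕ∞) *
      (nodalDomains (restrictToSphere (n + 1) (harmonicLift j P m))).encard := by
  have hkm' : (k : ℕ∞) ≤ C * ((m + 1 : ℕ) : ℕ∞) := by exact_mod_cast hkm
  calc (k : ℕ∞) ^ (n + 1)
      ≤ (C * (nodalDomains (restrictToSphere n P)).encard) * (C * ((m + 1 : ℕ) : ℕ∞)) := by
        rw [pow_succ]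
        gcongr
    _ = ((C ^ 2 : ℕ) : ℕ∞) *
          (((m + 1 : ℕ) : ℕ∞) * (nodalDomains (restrictToSphere n P)).encard) := by
        rw [Nat.cast_pow]
        ring
    _ ≤ _ := by
        gcongr
        exact mul_encard_nodalDomains_le_harmonicLift hP hj m

/-- The induction on the dimension spends half of the degree `k = m + j` on the lift and leaves the
other half for the polynomial in fewer variables. -/
lemma exists_harmonicPolynomials_many_nodalDomains (n : ℕ) :
    ∃ C : ℕ, C ≠ 0 ∧ ∀ k ≠ 0, ∃ j m, j ≠ 0 ∧ m + j = k ∧ k ≤ C * (m + 1) ∧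
      ∃ P ∈ harmonicPolynomials n j,
        (k : ℕ∞) ^ n ≤ C * (nodalDomains (restrictToSphere n P)).encard := by
  induction n with
  | zero =>
    refine ⟨1, one_ne_zero, fun k hk => ⟨1, k - 1, one_ne_zero, by omega, by omega,
      MvPolynomial.X 0, X_mem_harmonicPolynomials 0, ?_⟩⟩
    simpa using one_le_encard_nodalDomains (restrictToSphere_X_zero_ne_zero 0)
  | succ n ih =>
    obtain ⟨C, hC, hstep⟩ := ih
    have hC' : 2 ≤ 2 ^ (n + 1) * C ^ 2 := by
      have hpow : 2 ≤ 2 ^ (n + 1) := Nat.le_self_pow n.succ_ne_zero 2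
      exact hpow.trans (Nat.le_mul_of_pos_right _ (by positivity))
    refine ⟨2 ^ (n + 1) * C ^ 2, by positivity, fun k hk => ?_⟩
    obtain ⟨j, m, hj, hdegree, hle, P, hP, hcount⟩ := hstep (k - k / 2) (by omega)
    refine ⟨k - k / 2, k / 2, by omega, by omega, ?_, harmonicLift j P m,
      hdegree ▸ harmonicLift_mem_harmonicPolynomials hP m, ?_⟩
    · calc k ≤ 2 * (k / 2 + 1) := by omega
        _ ≤ 2 ^ (n + 1) * C ^ 2 * (k / 2 + 1) := by gcongr
    · have hhalf : (k : ℕ∞) ≤ 2 * ((k - k / 2 : ℕ) : ℕ∞) := by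
        have h : k ≤ 2 * (k - k / 2) := by omega
        exact_mod_cast h
      calc (k : ℕ∞) ^ (n + 1) ≤ (2 * ((k - k / 2 : ℕ) : ℕ∞)) ^ (n + 1) := by gcongr
        _ = 2 ^ (n + 1) * ((k - k / 2 : ℕ) : ℕ∞) ^ (n + 1) := mul_pow _ _ _
        _ ≤ 2 ^ (n + 1) * (((C ^ 2 : ℕ) : ℕ∞) *
              (nodalDomains (restrictToSphere (n + 1) (harmonicLift j P m))).encard) := by
            gcongr
            exact pow_succ_le_encard_harmonicLift hP hj hle hcount
        _ = _ := by
            push_cast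
            ring

lemma ofReal_inv_mul_pow_le (hC : C ≠ 0) {N : ℕ∞} (h : (k : ℕ∞) ^ n ≤ C * N) :
    ENNReal.ofReal ((C : ℝ)⁻¹ * (k : ℝ) ^ n) ≤ (N : ℝ≥0∞) := by
  have hcast : (k : ℝ≥0∞) ^ n ≤ C * (N : ℝ≥0∞) := by
    simpa using ENat.toENNReal_le.2 h
  have hCpos : (0 : ℝ) < C := by positivity
  rw [ENNReal.ofReal_mul (by positivity), ENNReal.ofReal_inv_of_pos hCpos,
    ENNReal.ofReal_pow (by positivity), ENNReal.ofReal_natCast, ENNReal.ofReal_natCast]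
  exact ENNReal.inv_mul_le_iff (by simpa) (by simp) |>.2 hcast

end Counting

end SphereNodal

end

theorem mainTheorem8 (n : ℕ) (hn : 1 ≤ n) :
    ∃ c₁ c₂ : ℝ, 0 < c₁ ∧ 0 < c₂ ∧
      ∃ Y : ℕ → SphereNodal.Sph n → ℝ, ∀ k : ℕ, 1 ≤ k →
        Y k ∈ SphereNodal.sphericalHarmonics n k ∧
        ENNReal.ofReal (c₁ * (k : ℝ) ^ n) ≤
          ((SphereNodal.nodalDomains (Y k)).encard : ℝ≥0∞) ∧
        ENNReal.ofReal (c₂ * (k : ℝ) ^ (n - 1)) ≤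
          (({Ω ∈ SphereNodal.nodalDomains (Y k) |
              SphereNodal.northPole n ∈ frontier Ω}).encard : ℝ≥0∞) := by
  obtain ⟨n, rfl⟩ := Nat.exists_eq_add_of_le' hn
  obtain ⟨C, hC, hexists⟩ := SphereNodal.exists_harmonicPolynomials_many_nodalDomains n
  choose! j m hj hdegree hle P hP hcount using hexists
  refine ⟨((C ^ 2 : ℕ) : ℝ)⁻¹, (C : ℝ)⁻¹, by positivity, by positivity,
    fun k => SphereNodal.restrictToSphere (n + 1) (SphereNodal.harmonicLift (j k) (P k) (m k)),
    fun k hk => ?_⟩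
  have hk0 : k ≠ 0 := Nat.one_le_iff_ne_zero.1 hk
  refine ⟨⟨_, ?_, rfl⟩, ?_, ?_⟩
  · simpa only [SetLike.mem_coe, hdegree k hk0] using
      SphereNodal.harmonicLift_mem_harmonicPolynomials (hP k hk0) (m k)
  · exact SphereNodal.ofReal_inv_mul_pow_le (pow_ne_zero 2 hC)
      (SphereNodal.pow_succ_le_encard_harmonicLift (hP k hk0) (hj k hk0) (hle k hk0) (hcount k hk0))
  · refine SphereNodal.ofReal_inv_mul_pow_le hC ((hcount k hk0).trans ?_)
    gcongr
    exact SphereNodal.encard_nodalDomains_le_frontier_harmonicLift (hP k hk0) (hj k hk0) (m k)
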